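/- Let $m\ge 1$ and $0\le n_3<n_2$ be integers, let $F:\mathcal X\to\mathbb R^{n_2}$ be a feature embedding, let $\bm x_1,\dots,\bm x_m\in\mathcal X$ be training instances with labels $y_1,\dots,y_m\in\mathcal Y$, and let $\bm x\in\mathcal X$ be a test instance with true label $y$. Assume that at least one training label differs from $y$, and let $r=\min\{\|F(\bm x)-F(\bm x_i)\| : y_i\neq y\}>0$. Let $\tau\ge 0$. $\textsc{RobustClassifier}(\tau,0)$ is the classifier $f$ on $\mathbb R^{n_2}$ that, given $\mathbf e$, returns the label of a training feature nearest to $\mathbf e$ (ties broken in any way) if $\min_i\|\mathbf e-F(\bm x_i)\|<\tau$, and returns "don't know" otherwise. For a probability distribution $\mathcal S$ on the space $\mathrm{Gr}(n_3,\mathbb R^{n_2})$ of $n_3$-dimensional linear subspaces of $\mathbb R^{n_2}$, the robust error of $f$ at $\bm x$ is $$\mathcal E_{\mathrm{adv}}^{\bm x}(f;\mathcal S)=\Pr_{S\sim\mathcal S}\big[\exists\,\mathbf e\in S+F(\bm x):\ f(\mathbf e)\neq y\text{ and } f(\mathbf e)\text{ is not ``don't know''}\big].$$ The uniform distribution on $\mathrm{Gr}(n_3,\mathbb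 R^{n_2})$ is the rotation-invariant probability measure; $\mathcal S$ is called $\kappa$-bounded if it has a density with respect to the uniform distribution that is at most $\kappa$. **Theorem.** There are absolute constants $c>0$, $0<c_0<1$ and $C>0$ such that in every such setting, with $$\mathbf E(\tau,r)=m\left(\frac{c\,\tau}{r\sqrt{1-n_3/n_2}}\right)^{n_2-n_3}+m\,c_0^{\,n_2-n_3},$$ the robust error of $f=\textsc{RobustClassifier}(\tau,0)$ against the uniform distribution is at most $\mathbf E(\tau,r)$, and for every $\kappa$ and every $\kappa$-bounded distribution $\mathcal S$ on $\mathrm{Gr}(n_3,\mathbb R^{n_2})$, $$\mathcal E_{\mathrm{adv}}^{\bm x}(f;\mathcal S)\le C\,\kappa\,\mathbf E(\tau,r).$$ (In particular this holds in the regime $\tau=o\big(r\sqrt{1-n_3/n_2}\big)$.) -/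

import Mathlib

open MeasureTheory TopologicalSpace
open scoped ENNReal

noncomputable section

namespace FeatureAttack

/-- The feature space `ℝⁿ` with its Euclidean norm. -/
abbrev Feat (n : ℕ) : Type := EuclideanSpace ℝ (Fin n)

/-! ### The space of `k`-dimensional linear subspaces of `ℝⁿ` and its uniform distribution -/

/-- The Grassmannian: all linear subspaces of `ℝⁿ` of dimension exactly `k`. -/
def Gr (n k : ℕ) : Type := {S : Submodule ℝ (Feat n) // Module.finrank ℝ S = k}

/-- The usual topology of the Grassmannian: a subspace is identified with the orthogonal projection
onto it, and projections are compared in the operator norm. -/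
instance (n k : ℕ) : TopologicalSpace (Gr n k) :=
  TopologicalSpace.induced (fun S => S.1.starProjection) inferInstance

instance (n k : ℕ) : MeasurableSpace (Gr n k) := borel _

instance (n k : ℕ) : BorelSpace (Gr n k) := ⟨rfl⟩

/-- The orthogonal group `O(n)`, as the group of linear maps `u` of `ℝⁿ` with `u* u = u u* = 1`,
with the operator norm topology and its Borel sets. -/
abbrev Orth (n : ℕ) : Type := unitary (Feat n →L[ℝ] Feat n)

instance (n : ℕ) : ContinuousStar (Feat n →L[ℝ] Feat n) :=
  ⟨(ContinuousLinearMap.adjoint (𝕜 := ℝ) (E := Feat n) (F := Feat n)).continuous⟩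

instance (n : ℕ) : CompactSpace (Orth n) := by
  apply isCompact_iff_compactSpace.mp
  apply Metric.isCompact_of_isClosed_isBounded
  · exact isClosed_unitary
  · refine (Metric.isBounded_iff_subset_closedBall 0).mpr ⟨1, fun u hu => ?_⟩
    rw [mem_closedBall_zero_iff]
    refine ContinuousLinearMap.opNorm_le_bound _ zero_le_one fun v => ?_
    rw [ContinuousLinearMap.norm_map_of_mem_unitary hu, one_mul]

/-- The normalized Haar measure of the orthogonal group: total mass `1`, invariant under
multiplication. -/
def haarOrth (n : ℕ) : Measure (Orth n) := Measure.haarMeasure (⊤ : PositiveCompacts (Orth n))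

instance (n : ℕ) : IsProbabilityMeasure (haarOrth n) :=
  ⟨by simpa [haarOrth] using Measure.haarMeasure_self (K₀ := (⊤ : PositiveCompacts (Orth n)))⟩

/-- The action of the orthogonal group on `k`-dimensional subspaces, `(u, S) ↦ u(S)`. -/
def rotate {n k : ℕ} (u : Orth n) (S : Gr n k) : Gr n k :=
  ⟨S.1.map (Unitary.linearIsometryEquiv u).toLinearEquiv.toLinearMap,
    (LinearEquiv.finrank_map_eq _ _).trans S.2⟩

lemma continuous_rotate {n k : ℕ} (S : Gr n k) : Continuous fun u : Orth n => rotate u S := by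
  rw [continuous_induced_rng]
  have : ((fun T : Gr n k => T.1.starProjection) ∘ fun u : Orth n => rotate u S) =
      fun u : Orth n => (u : Feat n →L[ℝ] Feat n) * S.1.starProjection *
        ((star u : Orth n) : Feat n →L[ℝ] Feat n) := by
    funext u
    ext1 v
    have h := Submodule.starProjection_map_apply (Unitary.linearIsometryEquiv u) S.1 v
    simp only [Function.comp, rotate]
    refine h.trans ?_
    rfl
  rw [this]
  fun_prop

/-- The coordinate subspace `{x : x_{k+1} = ⋯ = x_n = 0}`, spanned by the first `k` vectors of the
standard basis. -/
def coordSubspace {n k : ℕ} (h : k ≤ n) : Gr n k :=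
  ⟨Submodule.span ℝ (Set.range fun i : Fin k =>
      (EuclideanSpace.single (Fin.castLE h i) (1 : ℝ) : Feat n)), by
    have hl : LinearIndependent ℝ fun i : Fin k =>
        (EuclideanSpace.single (Fin.castLE h i) (1 : ℝ) : Feat n) := by
      have := (EuclideanSpace.basisFun (Fin n) ℝ).orthonormal.linearIndependent.comp
        (Fin.castLE h) (Fin.castLE_injective h)
      simpa [Function.comp_def] using this
    simpa using finrank_span_eq_card hl⟩

/-- The uniform distribution on `k`-dimensional linear subspaces of `ℝⁿ`: the law of `u(S₀)` for a
Haar-random rotation `u`, which is the unique rotation-invariant probability measure. -/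
def uniformGr {n k : ℕ} (h : k ≤ n) : Measure (Gr n k) :=
  (haarOrth n).map fun u => rotate u (coordSubspace h)

instance {n k : ℕ} (h : k ≤ n) : IsProbabilityMeasure (uniformGr h) :=
  Measure.isProbabilityMeasure_map (continuous_rotate _).measurable.aemeasurable

/-- A distribution on `k`-dimensional subspaces is `κ`-bounded if it has a density with respect to
the uniform distribution that is at most `κ`. -/
def IsKappaBounded {n k : ℕ} (h : k ≤ n) (κ : ℝ) (μ : Measure (Gr n k)) : Prop :=
  ∃ f : Gr n k → ℝ≥0∞, Measurable f ∧ (∀ S, f S ≤ ENNReal.ofReal κ) ∧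
    μ = (uniformGr h).withDensity f

/-! ### The classifier and its robust error -/

/-- The training examples that survive the preprocessing with separation parameter `σ`: example `i`
is deleted if some example of a different label is at distance less than `σ`. -/
def kept {n m : ℕ} {Y : Type*} (z : Fin m → Feat n) (ys : Fin m → Y) (σ : ℝ) : Set (Fin m) :=
  {i | ¬ ∃ j, ys i ≠ ys j ∧ dist (z i) (z j) < σ}

/-- `f` is the classifier with threshold `τ` and separation parameter `σ` for the training features
`z` and training labels `ys`: if some remaining training feature is at distance less than `τ` from
the input `e`, then `f e` is the label of a nearest remaining training feature (ties may be broken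
in any way); otherwise `f e = none`, that is, "don't know". -/
def IsRobustClassifier {n m : ℕ} {Y : Type*} (z : Fin m → Feat n) (ys : Fin m → Y) (τ σ : ℝ)
    (f : Feat n → Option Y) : Prop :=
  ∀ e, ((∃ i ∈ kept z ys σ, dist e (z i) < τ) →
      ∃ i ∈ kept z ys σ, (∀ j ∈ kept z ys σ, dist e (z i) ≤ dist e (z j)) ∧ f e = some (ys i)) ∧
    ((¬ ∃ i ∈ kept z ys σ, dist e (z i) < τ) → f e = none)

/-- The robust error of `f` at a test feature `p` of true label `y`: the probability, over the
random subspace `S`, that some `e ∈ S + p` is not labelled `y` although `f e` does not abstain. -/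
def robustError {n k : ℕ} {Y : Type*} (μ : Measure (Gr n k)) (f : Feat n → Option Y)
    (p : Feat n) (y : Y) : ℝ :=
  μ.real {S | ∃ e : Feat n, e - p ∈ S.1 ∧ f e ≠ none ∧ f e ≠ some y}

/-- The bound `m (c τ / (r √(1 - n₃/n₂)))^(n₂ - n₃) + m c₀^(n₂ - n₃)`. -/
def errorBound (c c₀ : ℝ) (m n₂ n₃ : ℕ) (τ r : ℝ) : ℝ :=
  m * (c * τ / (r * Real.sqrt (1 - (n₃ : ℝ) / n₂))) ^ (n₂ - n₃) + m * c₀ ^ (n₂ - n₃)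

end FeatureAttack

end

namespace FeatureAttack

/-! An error on `S` puts some wrongly labelled training feature `z i` within `τ` of the affine space
`S + p`, so `v = z i - p`, of norm at least `r`, has relative distance less than `τ / r` to `S`. A
union bound over at most `m` features reduces the theorem to a single vector.

For one vector, rotation invariance and Fubini (`haarOrth_mul_volume`) turn the probability of
relative distance below `s` into the share of the unit ball occupied by a cone around the coordinate
subspace. A diagonal map, with factor `b` along that subspace and `a / s` across it, sends this part
of the ball back into the ball when `a ^ 2 + b ^ 2 ≤ 1`, so the share is at most the inverse of its
determinant (`volume_slab_le`). Taking `a ^ 2 = 1 - k / n` and `b ^ 2 = k / n` costs only `b ^ (-k)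
≤ 2 ^ (n - k)`, which gives `c = 2`. A density at most `κ` multiplies the bound by `κ`, so `C = 1`.
-/

/-- The norm of the part of `x` beyond the first `k` coordinates is at most the distance of `x` to
the coordinate subspace. -/
lemma sum_tail_sq_le {n k : ℕ} (h : k ≤ n) (x : Feat n) :
    ∑ i : Fin n, (if (i : ℕ) < k then 0 else x i ^ 2) ≤
      ‖x - (coordSubspace h).1.starProjection x‖ ^ 2 := by
  have hz : ∀ w ∈ (coordSubspace h).1, ∀ i : Fin n, ¬ (i : ℕ) < k → w i = 0 := by
    intro w hw i hi
    have hle : (coordSubspace h).1 ≤ LinearMap.ker (EuclideanSpace.proj (𝕜 := ℝ) i).toLinearMap := by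
      refine Submodule.span_le.mpr ?_
      rintro _ ⟨j, rfl⟩
      have hij : i ≠ Fin.castLE h j := by
        rintro rfl
        exact hi (by simp)
      simp [hij]
    simpa using hle hw
  rw [EuclideanSpace.norm_sq_eq]
  refine Finset.sum_le_sum fun i _ => ?_
  split_ifs with hi
  · positivity
  · have := hz _ (Submodule.starProjection_apply_mem (coordSubspace h).1 x) i hi
    simp [this]

/-- The diagonal map with entries `b` on the first `k` coordinates and `a` on the others. -/
noncomputable def diagMap (n k : ℕ) (a b : ℝ) : Feat n →ₗ[ℝ] Feat n :=
  Matrix.toLin (EuclideanSpace.basisFun (Fin n) ℝ).toBasis (EuclideanSpace.basisFun (Fin n) ℝ).toBasis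
    (Matrix.diagonal fun i : Fin n => if (i : ℕ) < k then b else a)

lemma diagMap_apply {n k : ℕ} (a b : ℝ) (x : Feat n) (i : Fin n) :
    diagMap n k a b x i = (if (i : ℕ) < k then b else a) * x i := by
  simp only [diagMap, Matrix.toLin_apply, Matrix.mulVec_diagonal, WithLp.ofLp_sum,
    Finset.sum_apply, PiLp.smul_apply]
  rw [Finset.sum_eq_single i (fun j _ hj => by simp [hj.symm]) (by simp)]
  simp

lemma det_diagMap {n k : ℕ} (h : k ≤ n) (a b : ℝ) :
    LinearMap.det (diagMap n k a b) = b ^ k * a ^ (n - k) := by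
  obtain ⟨d, rfl⟩ := Nat.exists_eq_add_of_le h
  rw [diagMap, LinearMap.det_toLin, Matrix.det_diagonal, Fin.prod_univ_add]
  simp

/-- The volume of the points of the unit ball whose distance to the coordinate subspace is below
`s`, compared with the volume of the ball. -/
lemma volume_slab_le {n k : ℕ} (h : k ≤ n) {s a b : ℝ} (hs : 0 < s) (hab : a ^ 2 + b ^ 2 ≤ 1) :
    ENNReal.ofReal |b ^ k * (a / s) ^ (n - k)| *
      volume {x : Feat n | ‖x - (coordSubspace h).1.starProjection x‖ < s * ‖x‖ ∧ ‖x‖ ≤ 1} ≤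
    volume (Metric.closedBall (0 : Feat n) 1) := by
  rw [← det_diagMap h, ← Measure.addHaar_image_linearMap]
  refine measure_mono ?_
  rintro _ ⟨x, ⟨hx, hx1⟩, rfl⟩
  rw [mem_closedBall_zero_iff, ← sq_le_one_iff₀ (norm_nonneg _), EuclideanSpace.norm_sq_eq]
  have ht : ∑ i : Fin n, (if (i : ℕ) < k then 0 else x i ^ 2) ≤ s ^ 2 :=
    (sum_tail_sq_le h x).trans (by
      have : ‖x - (coordSubspace h).1.starProjection x‖ ≤ s := by nlinarith
      gcongr)
  have hh : ∑ i : Fin n, x i ^ 2 ≤ 1 := by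
    have := EuclideanSpace.norm_sq_eq x
    simp only [Real.norm_eq_abs, sq_abs] at this
    rw [← this]
    exact pow_le_one₀ (norm_nonneg _) hx1
  calc ∑ i, ‖diagMap n k (a / s) b x i‖ ^ 2
      ≤ ∑ i : Fin n, (b ^ 2 * x i ^ 2 + (a / s) ^ 2 * (if (i : ℕ) < k then 0 else x i ^ 2)) := by
        refine Finset.sum_le_sum fun i _ => ?_
        rw [diagMap_apply, Real.norm_eq_abs, sq_abs, mul_pow]
        split_ifs
        · simp
        · nlinarith [sq_nonneg (b * x i)]
    _ ≤ b ^ 2 * 1 + (a / s) ^ 2 * s ^ 2 := by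
        rw [Finset.sum_add_distrib, ← Finset.mul_sum, ← Finset.mul_sum]
        gcongr
    _ ≤ 1 := by
        rw [div_pow, div_mul_cancel₀ _ (by positivity)]
        linarith

lemma exists_orth_apply_eq {n : ℕ} {v w : Feat n} (h : ‖v‖ = ‖w‖) :
    ∃ u : Orth n, Unitary.linearIsometryEquiv u v = w :=
  ⟨Unitary.linearIsometryEquiv.symm (Submodule.reflection (ℝ ∙ (v - w))ᗮ), by
    rw [MulEquiv.apply_symm_apply]
    exact Submodule.reflection_sub h⟩

lemma norm_sub_starProjection_rotate {n k : ℕ} (u : Orth n) (S : Gr n k) (v : Feat n) :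
    ‖v - (rotate u S).1.starProjection v‖ =
      ‖Unitary.linearIsometryEquiv u⁻¹ v -
        S.1.starProjection (Unitary.linearIsometryEquiv u⁻¹ v)‖ := by
  have h : (rotate u S).1.starProjection v = Unitary.linearIsometryEquiv u
      (S.1.starProjection ((Unitary.linearIsometryEquiv u).symm v)) :=
    Submodule.starProjection_map_apply (Unitary.linearIsometryEquiv u) S.1 v
  have h' : Unitary.linearIsometryEquiv u⁻¹ v = (Unitary.linearIsometryEquiv u).symm v := by
    rw [map_inv]; rfl
  rw [h, h', ← LinearIsometryEquiv.norm_map (Unitary.linearIsometryEquiv u)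
    ((Unitary.linearIsometryEquiv u).symm v - _), map_sub, LinearIsometryEquiv.apply_symm_apply]

lemma rotate_mul {n k : ℕ} (u w : Orth n) (S : Gr n k) :
    rotate (u * w) S = rotate u (rotate w S) := by
  apply Subtype.ext
  simp only [rotate, map_mul]
  rw [← Submodule.map_comp]
  rfl

instance (n : ℕ) : (haarOrth n).IsMulLeftInvariant := by
  unfold haarOrth; infer_instance

/-- The law of the relative distance of a vector to a random rotation of `S` does not depend on
the vector. -/
lemma haarOrth_relDist_eq {n k : ℕ} (S : Gr n k) (s : ℝ) {v x : Feat n} (hv : v ≠ 0)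
    (hx : x ≠ 0) :
    haarOrth n {u | ‖x - (rotate u S).1.starProjection x‖ < s * ‖x‖} =
      haarOrth n {u | ‖v - (rotate u S).1.starProjection v‖ < s * ‖v‖} := by
  have hv' := norm_pos_iff.mpr hv
  have hx' := norm_pos_iff.mpr hx
  -- Some `w` carries `x` to a positive multiple of `v`; translating Haar measure by `w⁻¹` moves it
  -- from the vector onto the subspace.
  obtain ⟨w, hw⟩ := exists_orth_apply_eq (v := x) (w := (‖x‖ / ‖v‖) • v) (by
    rw [norm_smul, Real.norm_of_nonneg (by positivity)]; field_simp)
  rw [← measure_preimage_mul (haarOrth n) w⁻¹]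
  congr 1
  ext u
  have hc : (0 : ℝ) < ‖x‖ / ‖v‖ := by positivity
  simp only [Set.mem_preimage, Set.mem_ofPred_eq]
  rw [rotate_mul, norm_sub_starProjection_rotate, inv_inv, hw, map_smul, ← smul_sub, norm_smul,
    Real.norm_of_nonneg hc.le]
  have : s * ‖x‖ = ‖x‖ / ‖v‖ * (s * ‖v‖) := by field_simp
  rw [this, mul_lt_mul_iff_right₀ hc]

lemma volume_relDist_eq {n k : ℕ} (u : Orth n) (S : Gr n k) (s : ℝ) :
    volume {x : Feat n | ‖x - (rotate u S).1.starProjection x‖ < s * ‖x‖ ∧ ‖x‖ ≤ 1} =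
      volume {x : Feat n | ‖x - S.1.starProjection x‖ < s * ‖x‖ ∧ ‖x‖ ≤ 1} := by
  have hmp : MeasurePreserving (Unitary.linearIsometryEquiv u⁻¹).toMeasurableEquiv
      (volume : Measure (Feat n)) volume := LinearIsometryEquiv.measurePreserving _
  rw [← hmp.measure_preimage_equiv {x : Feat n | ‖x - S.1.starProjection x‖ < _ ∧ _}]
  congr 1
  ext x
  simp [norm_sub_starProjection_rotate]

/-- Double counting of pairs (rotation, point of the ball): every rotation sees the same volume of
points, and every nonzero point the same measure of rotations. -/
lemma haarOrth_mul_volume {n k : ℕ} (S : Gr n k) (s : ℝ) {v : Feat n} (hv : v ≠ 0) :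
    haarOrth n {u | ‖v - (rotate u S).1.starProjection v‖ < s * ‖v‖} *
      volume (Metric.closedBall (0 : Feat n) 1) =
    volume {x : Feat n | ‖x - S.1.starProjection x‖ < s * ‖x‖ ∧ ‖x‖ ≤ 1} := by
  -- In positive dimension the origin, where the fibre measure may differ, is a null set.
  have : Nontrivial (Feat n) := ⟨v, 0, hv⟩
  set B := Metric.closedBall (0 : Feat n) 1 with hB
  have : IsFiniteMeasure (volume.restrict B) :=
    ⟨by simpa using (isCompact_closedBall (0 : Feat n) 1).measure_lt_top⟩
  let A : Set (Orth n × Feat n) :=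
    {p | ‖p.2 - (rotate p.1 S).1.starProjection p.2‖ < s * ‖p.2‖}
  have hA : MeasurableSet A := by
    have hr : Continuous fun u : Orth n => (rotate u S).1.starProjection :=
      continuous_induced_rng.mp (continuous_rotate S)
    have h1 : Continuous fun p : Orth n × Feat n => (rotate p.1 S).1.starProjection p.2 :=
      (hr.comp continuous_fst).clm_apply continuous_snd
    exact measurableSet_lt (by fun_prop) (by fun_prop)
  have e1 : ((haarOrth n).prod (volume.restrict B)) A =
      volume {x : Feat n | ‖x - S.1.starProjection x‖ < s * ‖x‖ ∧ ‖x‖ ≤ 1} := by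
    rw [Measure.prod_apply hA]
    have : ∀ u : Orth n, volume.restrict B (Prod.mk u ⁻¹' A) =
        volume {x : Feat n | ‖x - S.1.starProjection x‖ < s * ‖x‖ ∧ ‖x‖ ≤ 1} := by
      intro u
      rw [Measure.restrict_apply (measurable_prodMk_left hA), ← volume_relDist_eq u S s]
      congr 1
      ext x
      simp [A, hB]
    simp [this]
  rw [← e1, Measure.prod_apply_symm hA]
  have : ∀ᵐ x ∂(volume.restrict B), haarOrth n ((fun u => (u, x)) ⁻¹' A) =
      haarOrth n {u | ‖v - (rotate u S).1.starProjection v‖ < s * ‖v‖} := by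
    refine ae_restrict_of_ae ?_
    filter_upwards [Measure.ae_ne volume (0 : Feat n)] with x hx
    exact haarOrth_relDist_eq S s hv hx
  rw [lintegral_congr_ae this]
  simp

/-- A random `k`-dimensional subspace is close to a fixed vector with small probability. -/
lemma uniformGr_relDist_le {n k : ℕ} (h : k < n) {s : ℝ} (hs : 0 < s) {v : Feat n} (hv : v ≠ 0) :
    uniformGr h.le {S | ‖v - S.1.starProjection v‖ < s * ‖v‖} ≤
      ENNReal.ofReal ((2 * s / Real.sqrt (1 - (k : ℝ) / n)) ^ (n - k)) := by
  have hn : (0 : ℝ) < n := by exact_mod_cast (Nat.zero_le k).trans_lt h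
  have hkn : (k : ℝ) < n := by exact_mod_cast h
  have hfrac : (k : ℝ) / n < 1 := (div_lt_one hn).mpr hkn
  have hd : (((n - k : ℕ) : ℝ)) = n - k := Nat.cast_sub h.le
  have hm : MeasurableSet {S : Gr n k | ‖v - S.1.starProjection v‖ < s * ‖v‖} := by
    have hr : Continuous fun S : Gr n k => S.1.starProjection := continuous_induced_dom
    have h1 : Continuous fun S : Gr n k => S.1.starProjection v := hr.clm_apply continuous_const
    exact measurableSet_lt (by fun_prop) (by fun_prop)
  rw [uniformGr, Measure.map_apply (continuous_rotate _).measurable hm]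
  set q := haarOrth n ((fun u => rotate u (coordSubspace h.le)) ⁻¹'
    {S | ‖v - S.1.starProjection v‖ < s * ‖v‖})
  set a := Real.sqrt (1 - (k : ℝ) / n) with ha
  set b := Real.sqrt ((k : ℝ) / n) with hb
  have ha2 : a ^ 2 = 1 - (k : ℝ) / n := Real.sq_sqrt (by linarith)
  have hb2 : b ^ 2 = (k : ℝ) / n := Real.sq_sqrt (by positivity)
  have ha0 : 0 < a := Real.sqrt_pos.mpr (by linarith)
  have key := volume_slab_le h.le (a := a) (b := b) hs (by rw [ha2, hb2]; simp)
  rw [← haarOrth_mul_volume (coordSubspace h.le) s hv, ← mul_assoc] at key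
  have hB0 : volume (Metric.closedBall (0 : Feat n) 1) ≠ 0 :=
    (Metric.measure_closedBall_pos _ _ one_pos).ne'
  have hB1 : volume (Metric.closedBall (0 : Feat n) 1) ≠ ⊤ :=
    (isCompact_closedBall (0 : Feat n) 1).measure_lt_top.ne
  have key2 : ENNReal.ofReal |b ^ k * (a / s) ^ (n - k)| * q ≤ 1 := by
    rw [← ENNReal.mul_le_mul_iff_left hB0 hB1, one_mul]
    exact key
  -- If `k = 0` then `b = 0`, but the factor is `0 ^ 0 = 1`.
  have hbpos : 0 < b ^ k := by
    rcases Nat.eq_zero_or_pos k with rfl | hk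
    · simp
    · exact pow_pos (Real.sqrt_pos.mpr (by positivity)) _
  -- Squared, this is `(n / k) ^ k ≤ 4 ^ (n - k)`, which follows from `(1 + (n - k) / k) ^ k ≤ exp
  -- (n - k)` and `e ≤ 4`.
  have hbk : 1 ≤ b ^ k * 2 ^ (n - k) := by
    rw [← one_le_sq_iff₀ (by positivity)]
    rcases Nat.eq_zero_or_pos k with rfl | hk
    · simp only [pow_zero, one_mul]
      exact one_le_pow₀ (one_le_pow₀ (by norm_num))
    have hk' : (0 : ℝ) < k := by exact_mod_cast hk
    have h1 : ((n : ℝ) / k) ^ k ≤ Real.exp ((n - k : ℕ) : ℝ) := by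
      calc ((n : ℝ) / k) ^ k = (((n - k : ℕ) : ℝ) / k + 1) ^ k := by
            rw [hd]; congr 1; field_simp; ring
        _ ≤ Real.exp (((n - k : ℕ) : ℝ) / k) ^ k := by
            gcongr; exact Real.add_one_le_exp _
        _ = Real.exp ((n - k : ℕ) : ℝ) := by
            rw [← Real.exp_nat_mul]; congr 1; field_simp
    have h2 : Real.exp ((n - k : ℕ) : ℝ) ≤ 4 ^ (n - k) := by
      rw [← Real.exp_one_pow]
      gcongr
      linarith [Real.exp_one_lt_d9]
    calc (1 : ℝ) = ((k : ℝ) / n) ^ k * ((n : ℝ) / k) ^ k := by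
          rw [← mul_pow]; field_simp; simp
      _ ≤ ((k : ℝ) / n) ^ k * 4 ^ (n - k) := by gcongr; exact h1.trans h2
      _ = (b ^ k * 2 ^ (n - k)) ^ 2 := by
          rw [← hb2, mul_pow, ← pow_mul, ← pow_mul, ← pow_mul, mul_comm 2 k, mul_comm (n - k) 2,
            pow_mul 2 2]
          norm_num
  have hpos : 0 < b ^ k * (a / s) ^ (n - k) := by positivity
  rw [abs_of_pos hpos] at key2
  calc q ≤ (ENNReal.ofReal (b ^ k * (a / s) ^ (n - k)))⁻¹ := by
        rw [ENNReal.le_inv_iff_mul_le, mul_comm]; exact key2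
    _ = ENNReal.ofReal ((b ^ k * (a / s) ^ (n - k))⁻¹) := (ENNReal.ofReal_inv_of_pos hpos).symm
    _ ≤ _ := by
        refine ENNReal.ofReal_le_ofReal (inv_le_of_inv_le₀ (by positivity) ?_)
        rw [inv_le_iff_one_le_mul₀ (by positivity)]
        calc (1 : ℝ) ≤ b ^ k * 2 ^ (n - k) := hbk
          _ = b ^ k * (a / s) ^ (n - k) * (2 * s / a) ^ (n - k) := by
            rw [mul_assoc, ← mul_pow]; congr 2; field_simp

/-- The set of subspaces on which the classifier errs is covered by the sets of subspaces that come
within `τ` of a training feature with a wrong label. -/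
lemma error_subset {n k m : ℕ} {Y : Type*} {z : Fin m → Feat n} {ys : Fin m → Y} {τ : ℝ}
    {f : Feat n → Option Y} (hf : IsRobustClassifier z ys τ 0 f) (p : Feat n) (y : Y) :
    {S : Gr n k | ∃ e : Feat n, e - p ∈ S.1 ∧ f e ≠ none ∧ f e ≠ some y} ⊆
      ⋃ i : {i // ys i ≠ y},
        {S : Gr n k | ‖(z i - p) - S.1.starProjection (z i - p)‖ < τ} := by
  rintro S ⟨e, heS, hnone, hy⟩
  obtain ⟨h1, h2⟩ := hf e
  have hex : ∃ i ∈ kept z ys 0, dist e (z i) < τ := by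
    by_contra hc
    exact hnone (h2 hc)
  obtain ⟨i, -, hmin, hfi⟩ := h1 hex
  obtain ⟨j, hj, hjτ⟩ := hex
  refine Set.mem_iUnion.mpr ⟨⟨i, fun hi => hy (by rw [hfi, hi])⟩, ?_⟩
  have hle : ‖(z i - p) - S.1.starProjection (z i - p)‖ ≤ ‖(z i - p) - (e - p)‖ := by
    rw [Submodule.starProjection_minimal]
    exact ciInf_le ⟨0, by rintro _ ⟨w, rfl⟩; positivity⟩ (⟨e - p, heS⟩ : S.1)
  refine hle.trans_lt ?_
  rw [sub_sub_sub_cancel_right, ← dist_eq_norm, dist_comm]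
  exact (hmin j hj).trans_lt hjτ

lemma uniformGr_error_le {n k m : ℕ} (h : k < n) {Y : Type*} {z : Fin m → Feat n}
    {ys : Fin m → Y} {τ r : ℝ} {f : Feat n → Option Y} (hf : IsRobustClassifier z ys τ 0 f)
    {p : Feat n} {y : Y} (hr : 0 < r) (hz : ∀ i, ys i ≠ y → r ≤ dist p (z i)) (hτ : 0 ≤ τ) :
    uniformGr h.le {S | ∃ e : Feat n, e - p ∈ S.1 ∧ f e ≠ none ∧ f e ≠ some y} ≤
      ENNReal.ofReal (errorBound 2 (1 / 2) m n k τ r) := by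
  classical
  set t := (2 * τ / (r * Real.sqrt (1 - (k : ℝ) / n))) ^ (n - k) with ht
  have ht0 : 0 ≤ t := by positivity
  have hi : ∀ i : {i // ys i ≠ y},
      uniformGr h.le {S | ‖(z i - p) - S.1.starProjection (z i - p)‖ < τ} ≤ ENNReal.ofReal t := by
    intro i
    -- For `τ = 0` the event is empty; the single-vector estimate needs `s = τ / r > 0`.
    rcases hτ.eq_or_lt with rfl | hτ
    · simp [not_lt.mpr (norm_nonneg _)]
    have hri : r ≤ ‖z i - p‖ := by
      rw [← dist_eq_norm, dist_comm]; exact hz i i.2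
    have hv : z i - p ≠ 0 := norm_pos_iff.mp (hr.trans_le hri)
    refine (measure_mono ?_).trans ((uniformGr_relDist_le h (div_pos hτ hr) hv).trans_eq ?_)
    · intro S hS
      refine lt_of_lt_of_le (Set.mem_ofPred_eq ▸ hS) ?_
      rw [div_mul_eq_mul_div, le_div_iff₀ hr]
      gcongr
    · rw [ht]; congr 2; rw [mul_div_assoc', div_div]
  calc _ ≤ ∑ i : {i // ys i ≠ y},
        uniformGr h.le {S | ‖(z i - p) - S.1.starProjection (z i - p)‖ < τ} :=
        (measure_mono (error_subset hf p y)).trans (measure_iUnion_fintype_le _ _)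
    _ ≤ ∑ _i : {i // ys i ≠ y}, ENNReal.ofReal t := Finset.sum_le_sum fun i _ => hi i
    _ = ENNReal.ofReal (Fintype.card {i // ys i ≠ y} * t) := by
        rw [ENNReal.ofReal_mul (by positivity)]
        simp
    _ ≤ _ := by
        refine ENNReal.ofReal_le_ofReal ?_
        have hc : (Fintype.card {i // ys i ≠ y} : ℝ) ≤ m := by
          exact_mod_cast (Fintype.card_subtype_le _).trans_eq (Fintype.card_fin m)
        -- The `c₀` term is pure slack: only its nonnegativity is used.
        have : (0 : ℝ) ≤ m * (1 / 2) ^ (n - k) := by positivity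
        have := mul_le_mul_of_nonneg_right hc ht0
        rw [errorBound, ← ht]
        linarith

lemma IsKappaBounded.measure_le {n k : ℕ} {h : k ≤ n} {κ : ℝ} {μ : Measure (Gr n k)}
    (hμ : IsKappaBounded h κ μ) : μ ≤ ENNReal.ofReal κ • uniformGr h := by
  obtain ⟨g, -, hg, rfl⟩ := hμ
  rw [← withDensity_const]
  exact withDensity_mono (Filter.Eventually.of_forall hg)

end FeatureAttack

theorem mainTheorem3 :
    ∃ c c₀ C : ℝ, 0 < c ∧ 0 < c₀ ∧ c₀ < 1 ∧ 0 < C ∧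
      ∀ (X Y : Type*) (n₂ n₃ m : ℕ) (h : n₃ < n₂) (F : X → FeatureAttack.Feat n₂)
        (xs : Fin m → X) (ys : Fin m → Y) (x : X) (y : Y) (r τ : ℝ)
        (f : FeatureAttack.Feat n₂ → Option Y),
        0 < r →
        IsLeast {d : ℝ | ∃ i, ys i ≠ y ∧ d = dist (F x) (F (xs i))} r →
        0 ≤ τ →
        FeatureAttack.IsRobustClassifier (fun i => F (xs i)) ys τ 0 f →
          FeatureAttack.robustError (FeatureAttack.uniformGr h.le) f (F x) y
              ≤ FeatureAttack.errorBound c c₀ m n₂ n₃ τ r ∧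
            ∀ (κ : ℝ) (μ : MeasureTheory.Measure (FeatureAttack.Gr n₂ n₃)),
              MeasureTheory.IsProbabilityMeasure μ →
              FeatureAttack.IsKappaBounded h.le κ μ →
              FeatureAttack.robustError μ f (F x) y
                ≤ C * (κ * FeatureAttack.errorBound c c₀ m n₂ n₃ τ r) := by
  refine ⟨2, 1 / 2, 1, by norm_num, by norm_num, by norm_num, one_pos, ?_⟩
  intro X Y n₂ n₃ m h F xs ys x y r τ f hr hleast hτ hf
  have hE : 0 ≤ FeatureAttack.errorBound 2 (1 / 2) m n₂ n₃ τ r := by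
    unfold FeatureAttack.errorBound; positivity
  have hu := FeatureAttack.uniformGr_error_le h hf (p := F x) (y := y) hr
    (fun i hi => hleast.2 ⟨i, hi, rfl⟩) hτ
  refine ⟨ENNReal.toReal_le_of_le_ofReal hE hu, fun κ μ hμ hκ => ?_⟩
  have hle := hκ.measure_le
  -- A negative `κ` would force the density, hence the probability measure `μ`, to vanish.
  have hκ0 : 0 ≤ κ := by
    by_contra hneg
    have := hle Set.univ
    simp [ENNReal.ofReal_of_nonpos (not_le.mp hneg).le] at this
  rw [one_mul]
  refine ENNReal.toReal_le_of_le_ofReal (mul_nonneg hκ0 hE) ((hle _).trans ?_)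
  rw [ENNReal.ofReal_mul hκ0, Measure.smul_apply, smul_eq_mul]
  gcongr
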